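/- Let $p$ be an odd prime, $F$ a finite unramified extension of $\mathbb{Q}_p$ with ring of integers $O_F$, uniformizer $\pi$ and residue field $\mathbb{F}_q$. Let $E/F$ be an unramified quadratic extension with ring of integers $O_E$, and let ${}^*$ denote the nontrivial automorphism of $E$ over $F$. For hermitian matrices $A\in M_{m,m}(O_E)$, $B\in M_{n,n}(O_E)$ (that is, ${}^tA^*=A$, ${}^tB^*=B$) the representation density is $$\alpha(A,B)=\lim_{d\to\infty}(q^{-d})^{n(2m-n)}\,\bigl|\{x\in M_{m,n}(O_E/\pi^dO_E)\;:\;{}^tx^*Ax\equiv B \pmod{\pi^d}\}\bigr|.$$ **Proposition A5.** Let $k,m,n\ge 0$ be integers with $k,n\le m$, and put $r=m-n$. Then the limit defining the following density exists, and $$\alpha\left(\begin{pmatrix}\pi 1_k & \\ & 1_{m-k}\end{pmatrix},\,1_n\right)=\prod_{l=1}^{n}\bigl(1-(-q)^{-l+k-r}\bigr).$$ -/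

import Mathlib

open Filter Topology

namespace HermitianDensity

section Local

variable (p : ℕ) [Fact p.Prime]
variable (F : Type*) [Field F] [Algebra ℤ_[p] F]
variable (E : Type*) [Field E] [Algebra F E]

/-- The ring of integers `O_F` of a finite extension `F` of `ℚ_p`: the elements of `F` that are
integral over `ℤ_p`. -/
abbrev baseIntegers : Type _ := integralClosure ℤ_[p] F

/-- The ring of integers `O_E` of a finite extension `E` of `F`: the elements of `E` that are
integral over `O_F`. -/
abbrev extIntegers : Type _ := integralClosure (baseIntegers p F) E

variable {F E}

/-- The restriction to `O_E` of an automorphism `σ` of `E` over `F`. -/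
noncomputable def conjIntegers (σ : E ≃ₐ[F] E) :
    extIntegers p F E ≃ₐ[baseIntegers p F] extIntegers p F E :=
  (σ.restrictScalars (baseIntegers p F)).mapIntegralClosure

end Local

section Density

variable {R S : Type*} [CommRing R] [CommRing S] [Algebra R S]

/-- The ideal `π ^ d S` of `S`, for an element `π` of the base ring `R`. -/
def powIdeal (S : Type*) [CommRing S] [Algebra R S] (π : R) (d : ℕ) : Ideal S :=
  Ideal.span {algebraMap R S π ^ d}

theorem powIdeal_le_comap (σ : S ≃ₐ[R] S) (π : R) (d : ℕ) :
    powIdeal S π d ≤ (powIdeal S π d).comap (σ : S →+* S) := by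
  unfold powIdeal
  rw [Ideal.span_le, Set.singleton_subset_iff, SetLike.mem_coe, Ideal.mem_comap]
  simp

/-- The conjugation on `S / π ^ d S` induced by the conjugation `σ` of `S` over `R`. -/
def conjMod (σ : S ≃ₐ[R] S) (π : R) (d : ℕ) :
    (S ⧸ powIdeal S π d) →+* (S ⧸ powIdeal S π d) :=
  Ideal.quotientMap (powIdeal S π d) (σ : S →+* S) (powIdeal_le_comap σ π d)

/-- The set of all `m × n` matrices `x` over `S / π ^ d S` such that
`ᵗx^* A x ≡ B` modulo `π ^ d`, where `^*` is the entrywise conjugation by `σ`. -/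
def congruenceSolutions (σ : S ≃ₐ[R] S) (π : R) {m n : ℕ}
    (A : Matrix (Fin m) (Fin m) S) (B : Matrix (Fin n) (Fin n) S) (d : ℕ) :
    Set (Matrix (Fin m) (Fin n) (S ⧸ powIdeal S π d)) :=
  {x | (x.map (conjMod σ π d)).transpose * A.map (Ideal.Quotient.mk (powIdeal S π d)) * x
      = B.map (Ideal.Quotient.mk (powIdeal S π d))}

/-- `HasDensity σ π A B a` says that the representation density
`α(A, B) = lim_{d → ∞} (q ^ (-d)) ^ (n (2 m - n)) * #{x ∈ M_{m,n}(S / π ^ d S) | A[x] ≡ B}`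
exists and is equal to `a`; here `q` is the number of elements of `R / π R` (the residue field
of `R` when `R` is a discrete valuation ring with uniformizer `π`). -/
def HasDensity (σ : S ≃ₐ[R] S) (π : R) {m n : ℕ}
    (A : Matrix (Fin m) (Fin m) S) (B : Matrix (Fin n) (Fin n) S) (a : ℝ) : Prop :=
  Tendsto (fun d : ℕ =>
      (((Nat.card (R ⧸ Ideal.span {π}) : ℝ) ^ (-(d : ℤ))) ^ ((n : ℤ) * (2 * (m : ℤ) - (n : ℤ)))) *
        ((congruenceSolutions σ π A B d).ncard : ℝ))
    atTop (𝓝 a)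

/-- The diagonal matrix `diag(π 1_k, 1_{m-k})` of size `m` (for `k ≤ m`). -/
def diagPiOne (S : Type*) [CommRing S] [Algebra R S] (π : R) (k m : ℕ) :
    Matrix (Fin m) (Fin m) S :=
  Matrix.diagonal fun i => if (i : ℕ) < k then algebraMap R S π else 1

end Density

end HermitianDensity

/-! The normalized count is already constant for `d ≥ 1`, so the limit is the value at `d = 1`.

Passing from `d` to `d + 1`: lift a solution to some `x` with `ᵗx^*Ax = 1 + π^d H`. Replacing `x` by
`x + π^d y` gives a solution exactly when the residue of `y` satisfies the linear equation `ᵗy^*Ax +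
ᵗx^*Ay = -H` over the residue field of `O_E`. This polarization map is onto the hermitian matrices,
because `x(H/2)` maps to `H` and 2 is invertible. Hermitian matrices number `q^(n²)`, so every fibre
has `q^(2mn - n²)` points, which the normalization cancels (`natCard_unitSolutions_lift`).

For `d = 1`: unramifiedness makes `O_E/π` a field with `q²` elements on which `σ` acts by `x ↦ x^q`
(`conjMod_one_eq_pow`), and the form becomes `diag(0_k, 1_{m-k})`. Solutions are orthonormal
`n`-frames, counted one vector at a time. If `W = Ku ⊕ W'` with `u` a unit vector orthogonal to
`W'`, the numbers of unit vectors satisfy `N(W) + q N(W') = (q + 1)|W'|`. Hence the counts in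
successive orthogonal complements are determined by sizes alone, without Witt cancellation, even
though the form may be degenerate (`natCard_frameOrthogonal`). Each step multiplies the deviation
`(-q)^(k-m)` by `-q`, which produces the factors of the product. -/

namespace HermitianDensity

/-! ### Integers in finite extensions of `ℚ_p` form a valuation ring. -/

section LocalIntegers

variable (p : ℕ) [Fact p.Prime] (L : Type*) [Field L] [Algebra ℚ_[p] L]
  [FiniteDimensional ℚ_[p] L] [Algebra ℤ_[p] L] [IsScalarTower ℤ_[p] ℚ_[p] L]

-- Both sides say that the minimal polynomial over `ℚ_p` has coefficients in `ℤ_p`; from left to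
-- right this uses that `ℤ_p` is integrally closed.
variable {L} in
theorem isIntegral_padicInt_iff_spectralNorm_le_one (x : L) :
    IsIntegral ℤ_[p] x ↔ spectralNorm ℚ_[p] L x ≤ 1 := by
  have hx : IsIntegral ℚ_[p] x := Algebra.IsIntegral.isIntegral x
  rw [spectralNorm, spectralValue_le_one_iff (minpoly.monic hx)]
  constructor
  · intro h n
    rw [minpoly.isIntegrallyClosed_eq_field_fractions' ℚ_[p] h, Polynomial.coeff_map]
    exact PadicInt.norm_le_one _
  · intro h
    have hl : minpoly ℚ_[p] x ∈ Polynomial.lifts (algebraMap ℤ_[p] ℚ_[p]) := by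
      rw [Polynomial.lifts_iff_coeff_lifts]
      exact fun n ↦ ⟨⟨_, h n⟩, rfl⟩
    obtain ⟨g, hg, -, hgm⟩ := Polynomial.lifts_and_natDegree_eq_and_monic hl (minpoly.monic hx)
    refine ⟨g, hgm, ?_⟩
    have := minpoly.aeval ℚ_[p] x
    rw [← hg, Polynomial.aeval_map_algebraMap] at this
    exact this

/-- The spectral norm over `ℚ_p` is multiplicative, so the norms of `x` and `x⁻¹` cannot both exceed
1. -/
theorem isIntegral_padicInt_or_inv (x : L) : IsIntegral ℤ_[p] x ∨ IsIntegral ℤ_[p] x⁻¹ := by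
  simp only [isIntegral_padicInt_iff_spectralNorm_le_one]
  by_cases hx : x = 0
  · left; simp [hx, spectralNorm_zero]
  have h : spectralNorm ℚ_[p] L x * spectralNorm ℚ_[p] L x⁻¹ = 1 := by
    have := map_mul (spectralMulAlgNorm ℚ_[p] L) x x⁻¹
    rw [mul_inv_cancel₀ hx, map_one] at this
    exact this.symm
  by_contra! hc
  nlinarith [hc.1, hc.2]

/-- The integral closure of `ℤ_p` in a finite extension of `ℚ_p` is a valuation ring. -/
theorem valuationRing_of_isIntegralClosure (C : Type*) [CommRing C] [IsDomain C] [Algebra C L]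
    [Algebra ℤ_[p] C] [IsScalarTower ℤ_[p] C L] [IsIntegralClosure C ℤ_[p] L] :
    ValuationRing C := by
  have : IsFractionRing C L :=
    IsIntegralClosure.isFractionRing_of_finite_extension ℤ_[p] ℚ_[p] L C
  rw [ValuationRing.iff_isInteger_or_isInteger C L]
  intro x
  exact (isIntegral_padicInt_or_inv p L x).imp
    (fun h ↦ IsIntegralClosure.isIntegral_iff.mp h)
    (fun h ↦ IsIntegralClosure.isIntegral_iff.mp h)

end LocalIntegers

theorem span_eq_maximalIdeal {R : Type*} [CommRing R] [IsLocalRing R]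
    [IsPrincipalIdealRing R] {π : R} (hπ : Irreducible π) :
    Ideal.span {π} = IsLocalRing.maximalIdeal R :=
  IsLocalRing.eq_maximalIdeal (PrincipalIdealRing.isMaximal_of_irreducible hπ)

/-! ### The residue ring `S/πS` and the conjugation it carries. -/

section PowIdeal

variable {R S : Type*} [CommRing R] [CommRing S] [Algebra R S]

theorem powIdeal_one (π : R) : powIdeal S π 1 = (Ideal.span {π}).map (algebraMap R S) := by
  rw [powIdeal, Ideal.map_span, Set.image_singleton, pow_one]

theorem conjMod_mk (σ : S ≃ₐ[R] S) (π : R) (d : ℕ) (x : S) :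
    conjMod σ π d (Ideal.Quotient.mk _ x) = Ideal.Quotient.mk _ (σ x) := rfl

end PowIdeal

theorem natCard_quotient_powIdeal_one {R S : Type*} [CommRing R] [IsDomain R]
    [IsLocalRing R] [IsPrincipalIdealRing R] [CommRing S] [Algebra R S] [Module.Finite R S]
    [Module.Free R S] (hrank : Module.finrank R S = 2) {π : R}
    (hπ : Irreducible π) [Finite (R ⧸ Ideal.span {π})] :
    Nat.card (S ⧸ powIdeal S π 1) = Nat.card (R ⧸ Ideal.span {π}) ^ 2 := by
  rw [powIdeal_one]
  rw [span_eq_maximalIdeal hπ] at *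
  let := Ideal.Quotient.field (IsLocalRing.maximalIdeal R)
  rw [Module.natCard_eq_pow_finrank (K := R ⧸ IsLocalRing.maximalIdeal R),
    IsLocalRing.finrank_quotient_map, hrank]

theorem algebraMap_ne_zero_of_finrank_eq_two {R S : Type*} [CommRing R] [IsDomain R]
    [CommRing S] [Algebra R S] [Module.Free R S] (hrank : Module.finrank R S = 2) {π : R}
    (hπ : π ≠ 0) : algebraMap R S π ≠ 0 := by
  have : Nontrivial S := Module.nontrivial_of_finrank_pos (R := R) (by lia)
  exact (map_ne_zero_iff _ (FaithfulSMul.algebraMap_injective R S)).2 hπ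

section Unramified

variable {R S : Type*} [CommRing R] [IsDomain R] [IsLocalRing R] [IsPrincipalIdealRing R]
  [CommRing S] [IsDomain S] [IsLocalRing S] [Algebra R S] [Module.Finite R S] [Module.Free R S]

theorem isMaximal_powIdeal_one [Algebra.FormallyUnramified R S] {π : R} (hπ : Irreducible π) :
    (powIdeal S π 1).IsMaximal := by
  rw [powIdeal_one, span_eq_maximalIdeal hπ]
  have : IsLocalHom (algebraMap R S) := inferInstance
  rw [Algebra.FormallyUnramified.map_maximalIdeal]
  infer_instance

/-- Over a formally unramified algebra, two algebra maps that agree modulo `I` are equal once the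
powers of `I` intersect in zero, which here is Krull's intersection theorem. -/
theorem conjMod_one_ne_id [Algebra.FormallyUnramified R S] {π : R} (hπ : Irreducible π)
    (σ : S ≃ₐ[R] S) (hσ : σ ≠ AlgEquiv.refl) :
    conjMod σ π 1 ≠ RingHom.id _ := by
  intro h
  apply hσ
  have : IsNoetherianRing S := IsNoetherianRing.of_finite R S
  have hI : ⨅ i, powIdeal S π 1 ^ i = ⊥ :=
    Ideal.iInf_pow_eq_bot_of_isDomain _ (isMaximal_powIdeal_one hπ).ne_top
  have := Algebra.FormallyUnramified.ext_of_iInf (R := R) _ hI (g₁ := (σ : S →ₐ[R] S))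
    (g₂ := AlgHom.id R S) (fun x ↦ RingHom.congr_fun h (Ideal.Quotient.mk _ x))
  ext x
  exact DFunLike.congr_fun this x

/-- The residue extension is quadratic, so its only automorphisms are the identity and Frobenius,
and the identity is excluded. -/
theorem conjMod_one_eq_pow [Algebra.FormallyUnramified R S] (hrank : Module.finrank R S = 2)
    {π : R} (hπ : Irreducible π) [Finite (R ⧸ Ideal.span {π})] (σ : S ≃ₐ[R] S)
    (hσ : σ ≠ AlgEquiv.refl) (x : S ⧸ powIdeal S π 1) :
    conjMod σ π 1 x = x ^ Nat.card (R ⧸ Ideal.span {π}) := by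
  have hne := conjMod_one_ne_id hπ σ hσ
  have hm := isMaximal_powIdeal_one (S := S) hπ
  have hcard := natCard_quotient_powIdeal_one (S := S) hrank hπ
  have hm' := PrincipalIdealRing.isMaximal_of_irreducible hπ
  let := Ideal.Quotient.field (Ideal.span {π})
  let := Ideal.Quotient.field (powIdeal S π 1)
  let : Algebra (R ⧸ Ideal.span {π}) (S ⧸ powIdeal S π 1) :=
    Ideal.Quotient.algebraQuotientOfLEComap (by rw [powIdeal_one]; exact Ideal.le_comap_map)
  have hpos : 0 < Nat.card (R ⧸ Ideal.span {π}) := Nat.card_pos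
  have hone : 1 < Nat.card (R ⧸ Ideal.span {π}) := Finite.one_lt_card
  have : Finite (S ⧸ powIdeal S π 1) :=
    Nat.finite_of_card_ne_zero (by rw [hcard]; positivity)
  let := Fintype.ofFinite (R ⧸ Ideal.span {π})
  have hfr : Module.finrank (R ⧸ Ideal.span {π}) (S ⧸ powIdeal S π 1) = 2 := by
    have := Module.natCard_eq_pow_finrank (K := R ⧸ Ideal.span {π}) (V := S ⧸ powIdeal S π 1)
    rw [hcard] at this
    exact (Nat.pow_right_injective hone this).symm
  let τ : (S ⧸ powIdeal S π 1) →ₐ[R ⧸ Ideal.span {π}] (S ⧸ powIdeal S π 1) :=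
    { conjMod σ π 1 with
      commutes' := by
        intro r
        obtain ⟨r, rfl⟩ := Ideal.Quotient.mk_surjective r
        change conjMod σ π 1 (Ideal.Quotient.mk _ (algebraMap R S r)) =
          Ideal.Quotient.mk _ (algebraMap R S r)
        rw [conjMod_mk, σ.commutes] }
  -- Every endomorphism is a Frobenius power with exponent below the degree 2.
  obtain ⟨⟨n, hn⟩, hτ⟩ := (FiniteField.bijective_frobeniusAlgHom_pow (R ⧸ Ideal.span {π})
    (S ⧸ powIdeal S π 1)).2 τ
  rw [hfr] at hn
  interval_cases n
  · exfalso
    apply hne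
    refine RingHom.ext fun x ↦ ?_
    have := DFunLike.congr_fun hτ x
    simp only [pow_zero] at this
    exact this.symm
  · have := DFunLike.congr_fun hτ x
    simp only [pow_one, FiniteField.coe_frobeniusAlgHom] at this
    rw [Nat.card_eq_fintype_card]
    exact this.symm

end Unramified

/-! ### Algebraic properties of `O_F`, `O_E` and the conjugation. -/

section General

variable (p : ℕ) [Fact p.Prime]

theorem isIntegral_baseIntegers_iff (F E : Type*) [Field F] [Field E]
    [Algebra F E] [Algebra ℤ_[p] F] [Algebra ℤ_[p] E] [IsScalarTower ℤ_[p] F E] (x : E) :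
    IsIntegral (baseIntegers p F) x ↔ IsIntegral ℤ_[p] x := by
  constructor
  · exact isIntegral_trans x
  · exact IsIntegral.tower_top

variable {F E : Type*} [Field F] [Field E] [Algebra F E] [Algebra ℤ_[p] F]

theorem conjIntegers_involutive [FiniteDimensional F E]
    (hE : Module.finrank F E = 2) (σ : E ≃ₐ[F] E)
    (x : extIntegers p F E) : conjIntegers p σ (conjIntegers p σ x) = x := by
  have hcard : Nat.card (E ≃ₐ[F] E) ≤ 2 := by
    rw [← hE, Nat.card_eq_fintype_card]
    exact AlgEquiv.card_le
  have hpos : 0 < Nat.card (E ≃ₐ[F] E) := Nat.card_pos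
  have hsq : σ ^ 2 = 1 := by
    have h := pow_card_eq_one' (x := σ)
    interval_cases hc : Nat.card (E ≃ₐ[F] E)
    · rw [pow_one] at h
      rw [h, one_pow]
    · exact h
  exact Subtype.ext (DFunLike.congr_fun hsq (x : E))

theorem isUnit_two_extIntegers (hp : 2 < p) : IsUnit (2 : extIntegers p F E) := by
  have h : IsUnit (2 : ℤ_[p]) := by
    by_contra h
    rw [PadicInt.not_isUnit_iff] at h
    have h2 := (PadicInt.norm_int_lt_one_iff_dvd (p := p) 2).1 (by exact_mod_cast h)
    have := Nat.le_of_dvd two_pos (by exact_mod_cast h2)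
    lia
  have := (h.map (algebraMap ℤ_[p] (baseIntegers p F))).map
    (algebraMap (baseIntegers p F) (extIntegers p F E))
  rwa [map_ofNat, map_ofNat] at this

end General

section IntegralClosure

variable (A L : Type*) [CommRing A] [IsDomain A] [IsPrincipalIdealRing A] [Field L] [Algebra A L]

theorem finite_integralClosure_of_isPrincipalIdealRing (K : Type*) [Field K] [CharZero K]
    [Algebra A K] [IsFractionRing A K] [Algebra K L] [FiniteDimensional K L] [IsScalarTower A K L] :
    Module.Finite A (integralClosure A L) :=
  IsIntegralClosure.finite A K L _

theorem free_integralClosure_of_isPrincipalIdealRing (K : Type*) [Field K] [CharZero K]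
    [Algebra A K] [IsFractionRing A K] [Algebra K L] [FiniteDimensional K L] [IsScalarTower A K L] :
    Module.Free A (integralClosure A L) :=
  have : Module.IsTorsionFree A L := .trans_faithfulSMul A K L
  IsIntegralClosure.module_free A K L _

theorem finrank_integralClosure_of_isPrincipalIdealRing (K : Type*) [Field K] [CharZero K]
    [Algebra A K] [IsFractionRing A K] [Algebra K L] [FiniteDimensional K L] [IsScalarTower A K L] :
    Module.finrank A (integralClosure A L) = Module.finrank K L :=
  have : Module.IsTorsionFree A L := .trans_faithfulSMul A K L
  IsIntegralClosure.rank A K L _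

end IntegralClosure

section Integers

variable (p : ℕ) [Fact p.Prime] (F : Type*) [Field F] [Algebra ℚ_[p] F]
  [FiniteDimensional ℚ_[p] F] [Algebra ℤ_[p] F] [IsScalarTower ℤ_[p] ℚ_[p] F]

theorem valuationRing_baseIntegers : ValuationRing (baseIntegers p F) :=
  valuationRing_of_isIntegralClosure p F _

theorem finite_baseIntegers : Module.Finite ℤ_[p] (baseIntegers p F) :=
  IsIntegralClosure.finite ℤ_[p] ℚ_[p] F _

theorem isPrincipalIdealRing_baseIntegers : IsPrincipalIdealRing (baseIntegers p F) := by
  have := valuationRing_baseIntegers p F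
  have := integralClosure.isNoetherianRing (A := ℤ_[p]) (K := ℚ_[p]) F
  infer_instance

theorem isFractionRing_baseIntegers : IsFractionRing (baseIntegers p F) F :=
  integralClosure.isFractionRing_of_finite_extension ℚ_[p] F

theorem finite_quotient_span_irreducible {π : baseIntegers p F} (hπ : Irreducible π) :
    Finite (baseIntegers p F ⧸ Ideal.span {π}) := by
  have := valuationRing_baseIntegers p F
  have := isPrincipalIdealRing_baseIntegers p F
  have := finite_baseIntegers p F
  rw [span_eq_maximalIdeal hπ]
  have : Module.IsTorsionFree ℤ_[p] F := .trans_faithfulSMul ℤ_[p] ℚ_[p] F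
  have : Module.IsTorsionFree ℤ_[p] (baseIntegers p F) := IsIntegralClosure.isTorsionFree ℤ_[p] F
  have : IsLocalHom (algebraMap ℤ_[p] (baseIntegers p F)) := inferInstance
  exact IsLocalRing.ResidueField.finite_of_finite (R := ℤ_[p]) (S := baseIntegers p F)
    (Finite.of_equiv _ (PadicInt.residueField (p := p)).symm.toEquiv)

variable (E : Type*) [Field E] [Algebra F E] [FiniteDimensional F E]

/-- By transitivity of integrality, `O_E` is also the integral closure of `ℤ_p` in `E`. The algebra
structures of `E` over `ℚ_p` and `ℤ_p` are defined through `F`. -/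
theorem valuationRing_extIntegers : ValuationRing (extIntegers p F E) := by
  let _ : Algebra ℚ_[p] E := ((algebraMap F E).comp (algebraMap ℚ_[p] F)).toAlgebra
  let _ : Algebra ℤ_[p] E := ((algebraMap F E).comp (algebraMap ℤ_[p] F)).toAlgebra
  have : IsScalarTower ℚ_[p] F E := .of_algebraMap_eq fun _ ↦ rfl
  have : IsScalarTower ℤ_[p] F E := .of_algebraMap_eq fun _ ↦ rfl
  have : IsScalarTower ℤ_[p] ℚ_[p] E := .of_algebraMap_eq fun x ↦ by
    rw [IsScalarTower.algebraMap_apply ℤ_[p] F E, IsScalarTower.algebraMap_apply ℤ_[p] ℚ_[p] F]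
    rfl
  have : FiniteDimensional ℚ_[p] E := Module.Finite.trans F E
  have : IsIntegralClosure (extIntegers p F E) ℤ_[p] E :=
    ⟨Subtype.val_injective, fun {x} ↦ by
      rw [← isIntegral_baseIntegers_iff p F E]
      exact IsIntegralClosure.isIntegral_iff (A := extIntegers p F E)⟩
  exact valuationRing_of_isIntegralClosure p E _

theorem finite_extIntegers : Module.Finite (baseIntegers p F) (extIntegers p F E) := by
  have := isFractionRing_baseIntegers p F
  have := isPrincipalIdealRing_baseIntegers p F
  have : CharZero F := charZero_of_injective_algebraMap (algebraMap ℚ_[p] F).injective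
  exact finite_integralClosure_of_isPrincipalIdealRing (baseIntegers p F) E F

theorem free_extIntegers : Module.Free (baseIntegers p F) (extIntegers p F E) := by
  have := isFractionRing_baseIntegers p F
  have := isPrincipalIdealRing_baseIntegers p F
  have : CharZero F := charZero_of_injective_algebraMap (algebraMap ℚ_[p] F).injective
  exact free_integralClosure_of_isPrincipalIdealRing (baseIntegers p F) E F

theorem finrank_extIntegers :
    Module.finrank (baseIntegers p F) (extIntegers p F E) = Module.finrank F E := by
  have := isFractionRing_baseIntegers p F
  have := isPrincipalIdealRing_baseIntegers p F
  have : CharZero F := charZero_of_injective_algebraMap (algebraMap ℚ_[p] F).injective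
  exact finrank_integralClosure_of_isPrincipalIdealRing (baseIntegers p F) E F

variable {F E}

theorem conjIntegers_ne_refl {σ : E ≃ₐ[F] E} (hσ : σ ≠ AlgEquiv.refl) :
    conjIntegers p σ ≠ AlgEquiv.refl := by
  have := isFractionRing_baseIntegers p F
  have : CharZero F := charZero_of_injective_algebraMap (algebraMap ℚ_[p] F).injective
  have : IsFractionRing (extIntegers p F E) E :=
    integralClosure.isFractionRing_of_finite_extension F E
  intro h
  apply hσ
  ext x
  obtain ⟨a, b, -, rfl⟩ := IsFractionRing.div_surjective (extIntegers p F E) x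
  have key (c : extIntegers p F E) : σ (algebraMap _ E c) = algebraMap _ E c :=
    congrArg (algebraMap (extIntegers p F E) E) (DFunLike.congr_fun h c)
  rw [map_div₀, key, key]
  rfl

end Integers

/-! ### Norm equations over a field with `q²` elements. -/

section NormForm

variable {K : Type*} [Field K] [Finite K] {q : ℕ} {τ : K →+* K}

theorem one_lt_of_natCard_eq_sq (hK : Nat.card K = q ^ 2) : 1 < q := by
  have h := Finite.one_lt_card (α := K)
  rw [hK] at h
  by_contra! hq
  interval_cases q <;> simp at h

theorem natCard_units_eq (hK : Nat.card K = q ^ 2) : Nat.card Kˣ = (q - 1) * (q + 1) := by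
  have hq := one_lt_of_natCard_eq_sq hK
  rw [Nat.card_units, hK]
  obtain ⟨k, rfl⟩ : ∃ k, q = k + 1 := ⟨q - 1, by lia⟩
  have : (k + 1) ^ 2 = k * (k + 1 + 1) + 1 := by ring
  rw [this]
  simp

/-- In the cyclic group `Kˣ` of order `(q - 1)(q + 1)`, the image of the `(q + 1)`-st power lies in
the kernel of the `(q - 1)`-st, and both have order `q - 1`. This is surjectivity of the norm. -/
theorem mem_range_powMonoidHom_of_pow_eq_one (hK : Nat.card K = q ^ 2) {c : Kˣ}
    (hc : c ^ (q - 1) = 1) : c ∈ (powMonoidHom (q + 1) : Kˣ →* Kˣ).range := by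
  have hq := one_lt_of_natCard_eq_sq hK
  have hU := natCard_units_eq hK
  have hle : (powMonoidHom (q + 1) : Kˣ →* Kˣ).range ≤ (powMonoidHom (q - 1) : Kˣ →* Kˣ).ker := by
    rintro _ ⟨u, rfl⟩
    rw [MonoidHom.mem_ker, powMonoidHom_apply, powMonoidHom_apply, ← pow_mul, mul_comm, ← hU]
    exact pow_card_eq_one'
  have hcard : Nat.card (powMonoidHom (q + 1) : Kˣ →* Kˣ).range =
      Nat.card (powMonoidHom (q - 1) : Kˣ →* Kˣ).ker := by
    rw [IsCyclic.card_powMonoidHom_range, IsCyclic.card_powMonoidHom_ker, hU,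
      Nat.gcd_eq_right (Dvd.intro_left _ rfl), Nat.gcd_eq_right (Dvd.intro _ rfl),
      Nat.mul_div_cancel _ (by lia)]
  have := Subgroup.eq_of_le_of_card_ge hle hcard.ge
  rw [this]
  exact hc

theorem natCard_norm_eq_zero {K : Type*} [Field K] {τ : K →+* K} :
    Nat.card {a : K // τ a * a = 0} = 1 := by
  have : Unique {a : K // τ a * a = 0} :=
    ⟨⟨0, by simp⟩, fun a ↦ Subtype.ext (by simpa using a.2)⟩
  exact Nat.card_unique

theorem natCard_norm_eq_of_ne_zero (hK : Nat.card K = q ^ 2) (hτ : ∀ x, τ x = x ^ q) {c : K}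
    (hc : τ c = c) (h0 : c ≠ 0) : Nat.card {a : K // τ a * a = c} = q + 1 := by
  have hq := one_lt_of_natCard_eq_sq hK
  lift c to Kˣ using h0.isUnit
  have hc1 : c ^ (q - 1) = 1 := by
    have : c ^ (q - 1) * c = c := by
      ext
      rw [← pow_succ, Nat.sub_add_cancel hq.le, Units.val_pow_eq_pow_val, ← hτ, hc]
    simpa using this
  obtain ⟨b, rfl⟩ := mem_range_powMonoidHom_of_pow_eq_one hK hc1
  have hker : Nat.card (powMonoidHom (q + 1) : Kˣ →* Kˣ).ker = q + 1 := by
    rw [IsCyclic.card_powMonoidHom_ker, natCard_units_eq hK,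
      Nat.gcd_eq_right (Dvd.intro_left _ rfl)]
  refine Eq.trans (Eq.symm ?_) hker
  refine Nat.card_eq_of_bijective
    (fun u : (powMonoidHom (q + 1) : Kˣ →* Kˣ).ker ↦
      (⟨((b * u.1 : Kˣ) : K), ?_⟩ : {a : K // τ a * a = _})) ⟨?_, ?_⟩
  · have hu : u.1 ^ (q + 1) = 1 := u.2
    rw [hτ, ← pow_succ, ← Units.val_pow_eq_pow_val, mul_pow, hu, mul_one]
    rfl
  · intro u v huv
    have : b * u.1 = b * v.1 := Units.ext (Subtype.ext_iff.1 huv)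
    exact Subtype.ext (mul_left_cancel this)
  · rintro ⟨a, ha⟩
    rw [hτ, ← pow_succ] at ha
    have ha0 : a ≠ 0 := by
      rintro rfl
      rw [zero_pow (by lia)] at ha
      exact Units.ne_zero _ ha.symm
    lift a to Kˣ using ha0.isUnit
    refine ⟨⟨b⁻¹ * a, ?_⟩, by simp⟩
    rw [MonoidHom.mem_ker, powMonoidHom_apply, mul_pow, inv_pow, inv_mul_eq_one]
    rw [← Units.val_pow_eq_pow_val] at ha
    exact (Units.ext ha).symm

/-- Fibre over `w`: the norm equation for the first coordinate has one solution if `φ w = c` and `q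
+ 1` otherwise. The second summand on the left makes up the missing `q`. -/
theorem natCard_norm_add_eq (hK : Nat.card K = q ^ 2) (hτ : ∀ x, τ x = x ^ q) {W : Type*}
    [Finite W] (φ : W → K) (hφ : ∀ w, τ (φ w) = φ w) {c : K} (hc : τ c = c) :
    Nat.card {x : K × W // τ x.1 * x.1 + φ x.2 = c} + q * Nat.card {w // φ w = c} =
      (q + 1) * Nat.card W := by
  classical
  have := Fintype.ofFinite W
  have e : {x : K × W // τ x.1 * x.1 + φ x.2 = c} ≃ Σ w : W, {a : K // τ a * a = c - φ w} :=
    { toFun := fun x ↦ ⟨x.1.2, x.1.1, eq_sub_of_add_eq x.2⟩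
      invFun := fun x ↦ ⟨(x.2.1, x.1), by rw [x.2.2, sub_add_cancel]⟩
      left_inv := fun _ ↦ rfl
      right_inv := fun _ ↦ rfl }
  have hfib (w : W) : Nat.card {a : K // τ a * a = c - φ w} + q * (if φ w = c then 1 else 0) =
      q + 1 := by
    split_ifs with h
    · rw [h, sub_self, natCard_norm_eq_zero]
      ring
    · rw [natCard_norm_eq_of_ne_zero hK hτ (by rw [map_sub, hc, hφ])
        (sub_ne_zero.2 (Ne.symm h))]
      ring
  rw [Nat.card_congr e, Nat.card_sigma, Nat.card_eq_fintype_card (α := {w // φ w = c}),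
    Fintype.card_subtype, Finset.card_filter, Finset.mul_sum, ← Finset.sum_add_distrib,
    Finset.sum_congr rfl (fun w _ ↦ hfib w), Finset.sum_const, Finset.card_univ,
    Nat.card_eq_fintype_card, smul_eq_mul, mul_comm]

/-- The number of vectors of norm one for a diagonal hermitian form with entries `0` and `1`. -/
theorem natCard_diagonal_norm_eq_one (hK : Nat.card K = q ^ 2) (hτ : ∀ x, τ x = x ^ q) {m : ℕ}
    (P : Fin m → Prop) [DecidablePred P] :
    (Nat.card {v : Fin m → K // ∑ i, (if P i then 0 else 1) * (τ (v i) * v i) = 1} : ℝ) =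
      (q : ℝ) ^ (2 * (m : ℤ) - 1) * (1 - (-(q : ℝ)) ^ (-(∑ i, if P i then 0 else 1 : ℤ))) := by
  have hq := one_lt_of_natCard_eq_sq hK
  have hq0 : (q : ℝ) ≠ 0 := by positivity
  have hττ (x : K) : τ (τ x) = x := by
    have := Fintype.ofFinite K
    rw [hτ, hτ, ← pow_mul, ← sq, ← hK, Nat.card_eq_fintype_card, FiniteField.pow_card]
  -- Write the count as `q^(2m-1)(1 - x)`. A coordinate with coefficient 0 is free and keeps `x`;
  -- one with coefficient 1 replaces `x` by `x/(-q)`, by `natCard_norm_add_eq`.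
  induction m with
  | zero => simp
  | succ m ih =>
    have e : {v : Fin (m + 1) → K // ∑ i, (if P i then 0 else 1) * (τ (v i) * v i) = 1} ≃
        {x : K × (Fin m → K) // (if P 0 then 0 else 1) * (τ x.1 * x.1) +
          ∑ i : Fin m, (if P i.succ then 0 else 1) * (τ (x.2 i) * x.2 i) = 1} :=
      ((Fin.consEquiv (fun _ ↦ K)).subtypeEquiv fun x ↦ by
        rw [Fin.sum_univ_succ]; rfl).symm
    have ih' := ih (fun i ↦ P i.succ)
    rw [Nat.card_congr e, Fin.sum_univ_succ]
    by_cases h0 : P 0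
    · simp only [h0, if_true, zero_mul, zero_add]
      have e2 : {x : K × (Fin m → K) //
          ∑ i : Fin m, (if P i.succ then 0 else 1) * (τ (x.2 i) * x.2 i) = 1} ≃
          K × {v : Fin m → K // ∑ i, (if P i.succ then 0 else 1) * (τ (v i) * v i) = 1} :=
        { toFun := fun x ↦ (x.1.1, ⟨x.1.2, x.2⟩)
          invFun := fun x ↦ ⟨(x.1, x.2.1), x.2.2⟩
          left_inv := fun _ ↦ rfl
          right_inv := fun _ ↦ rfl }
      rw [Nat.card_congr e2, Nat.card_prod, Nat.cast_mul, ih', hK]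
      push_cast
      rw [show 2 * ((m : ℤ) + 1) - 1 = 2 + (2 * m - 1) by ring, zpow_add₀ hq0 2, ← zpow_natCast]
      push_cast
      ring
    · simp only [h0, if_false, one_mul]
      have key := natCard_norm_add_eq hK hτ
        (fun v : Fin m → K ↦ ∑ i, (if P i.succ then 0 else 1) * (τ (v i) * v i))
        (fun v ↦ by
          rw [map_sum]
          refine Finset.sum_congr rfl fun i _ ↦ ?_
          rw [map_mul, map_mul, hττ, mul_comm (v i)]
          split_ifs <;> simp) (map_one τ)
      have hW : Nat.card (Fin m → K) = q ^ (2 * m) := by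
        rw [Nat.card_fun, hK, Nat.card_fin, ← pow_mul]
      have key' := congrArg (Nat.cast : ℕ → ℝ) key
      rw [hW] at key'
      push_cast at key'
      rw [ih'] at key'
      rw [eq_sub_of_add_eq key']
      set M : ℤ := ∑ i : Fin m, if P i.succ then 0 else 1
      have hq1 : (-(q : ℝ)) ≠ 0 := neg_ne_zero.2 hq0
      push_cast
      rw [show 2 * ((m : ℤ) + 1) - 1 = (2 * m : ℕ) + 1 by push_cast; ring, zpow_add₀ hq0,
        zpow_natCast, zpow_one,
        show 2 * (m : ℤ) - 1 = (2 * m : ℕ) - 1 by push_cast; ring, zpow_sub₀ hq0, zpow_natCast,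
        zpow_one, neg_add, zpow_add₀ hq1, zpow_neg_one]
      field_simp
      ring

/-- Supplies the nonzero skew element `u - τ u` used to count hermitian matrices. -/
theorem exists_map_ne_self (hK : Nat.card K = q ^ 2) (hτ : ∀ x, τ x = x ^ q) :
    ∃ x, τ x ≠ x := by
  have hq := one_lt_of_natCard_eq_sq hK
  by_contra! hfix
  have hker : (powMonoidHom (q - 1) : Kˣ →* Kˣ).ker = ⊤ := by
    refine eq_top_iff.2 fun u _ ↦ ?_
    have : u ^ (q - 1) * u = u := by
      ext
      rw [← pow_succ, Nat.sub_add_cancel hq.le, Units.val_pow_eq_pow_val, ← hτ, hfix]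
    simpa using this
  have hcard := IsCyclic.card_powMonoidHom_ker (G := Kˣ) (q - 1)
  rw [hker, Subgroup.card_top, natCard_units_eq hK, Nat.gcd_eq_right (Dvd.intro _ rfl)] at hcard
  have : 0 < q - 1 := by lia
  nlinarith

theorem map_map_self (hK : Nat.card K = q ^ 2) (hτ : ∀ x, τ x = x ^ q) (x : K) :
    τ (τ x) = x := by
  have := Fintype.ofFinite K
  rw [hτ, hτ, ← pow_mul, ← sq, ← hK, Nat.card_eq_fintype_card, FiniteField.pow_card]

end NormForm

/-! ### Counting orthonormal frames of a hermitian form. -/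

section Frames

variable {K : Type*} [Field K] {q : ℕ} {τ : K →+* K}
  {V : Type*} [AddCommGroup V] [Module K V] (h : V →ₛₗ[τ] V →ₗ[K] K)

/-- The orthonormal families of `n` vectors. -/
abbrev OrthonormalFrame (n : ℕ) : Type _ :=
  {z : Fin n → V // ∀ i j, h (z i) (z j) = if i = j then 1 else 0}

/-- The vectors orthogonal to all members of a family. -/
def frameOrthogonal {n : ℕ} (z : Fin n → V) : Submodule K V := ⨅ i, LinearMap.ker (h (z i))

theorem mem_frameOrthogonal {n : ℕ} {z : Fin n → V} {v : V} :
    v ∈ frameOrthogonal h z ↔ ∀ i, h (z i) v = 0 := by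
  simp [frameOrthogonal]

/-- Splitting off a vector of norm one. -/
def splitUnitVector (W : Submodule K V) (u : V) (hu : u ∈ W) (hu1 : h u u = 1) :
    W ≃ K × ↥(LinearMap.ker (h u) ⊓ W) where
  toFun w := (h u w, ⟨w - h u w • u, by
    refine ⟨?_, W.sub_mem w.2 (W.smul_mem _ hu)⟩
    change h u (w - h u w • u) = 0
    rw [map_sub, map_smul, hu1, smul_eq_mul, mul_one, sub_self]⟩)
  invFun x := ⟨x.1 • u + x.2, W.add_mem (W.smul_mem _ hu) x.2.2.2⟩
  left_inv w := by ext; simp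
  right_inv x := by
    have hx : h u x.2 = 0 := x.2.2.1
    ext <;> simp [hx, hu1]

theorem splitUnitVector_norm (hherm : ∀ v w, τ (h v w) = h w v) (W : Submodule K V) (u : V)
    (hu : u ∈ W) (hu1 : h u u = 1) (w : W) :
    h w w = τ (splitUnitVector h W u hu hu1 w).1 * (splitUnitVector h W u hu hu1 w).1 +
      h (splitUnitVector h W u hu hu1 w).2 (splitUnitVector h W u hu hu1 w).2 := by
  change h w w = τ (h u w) * h u w + h (w - h u w • u) (w - h u w • u)
  simp only [map_sub, LinearMap.sub_apply, map_smul, LinearMap.map_smulₛₗ, LinearMap.smul_apply,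
    smul_eq_mul, hu1]
  rw [← hherm u w]
  ring

theorem natCard_eq_of_unitVector (hK : Nat.card K = q ^ 2) (W : Submodule K V) (u : V)
    (hu : u ∈ W) (hu1 : h u u = 1) :
    Nat.card W = q ^ 2 * Nat.card ↥(LinearMap.ker (h u) ⊓ W) := by
  rw [Nat.card_congr (splitUnitVector h W u hu hu1), Nat.card_prod, hK]

theorem natCard_norm_eq_one_of_unitVector [Finite K] [Finite V] (hK : Nat.card K = q ^ 2)
    (hτ : ∀ x, τ x = x ^ q) (hherm : ∀ v w, τ (h v w) = h w v) (W : Submodule K V) (u : V)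
    (hu : u ∈ W) (hu1 : h u u = 1) :
    Nat.card {w : W // h w w = 1} +
        q * Nat.card {w : ↥(LinearMap.ker (h u) ⊓ W) // h w w = 1} =
      (q + 1) * Nat.card ↥(LinearMap.ker (h u) ⊓ W) := by
  rw [← natCard_norm_add_eq hK hτ (fun w : ↥(LinearMap.ker (h u) ⊓ W) ↦ h w w)
    (fun w ↦ hherm w w) (map_one τ)]
  congr 1
  refine Nat.card_congr ((splitUnitVector h W u hu hu1).subtypeEquiv fun w ↦ ?_)
  rw [splitUnitVector_norm h hherm W u hu hu1 w]

theorem frameOrthogonal_succ {n : ℕ} (z : Fin (n + 1) → V) :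
    frameOrthogonal h z = LinearMap.ker (h (z 0)) ⊓ frameOrthogonal h (Fin.tail z) := by
  ext v
  simp [mem_frameOrthogonal, Fin.forall_fin_succ, Fin.tail]

/-- Passing to the complement of one more unit vector divides the size by `q²`, and
`natCard_norm_eq_one_of_unitVector` then replaces `x` by `-qx`. Nondegeneracy plays no role, and the
counts do not depend on the frame. -/
theorem natCard_frameOrthogonal [Finite K] [Finite V] (hK : Nat.card K = q ^ 2)
    (hτ : ∀ x, τ x = x ^ q) (hherm : ∀ v w, τ (h v w) = h w v) {m : ℕ} {x : ℝ}
    (hV : Nat.card V = q ^ (2 * m))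
    (hN : (Nat.card {v : V // h v v = 1} : ℝ) = (q : ℝ) ^ (2 * (m : ℤ) - 1) * (1 - x))
    {n : ℕ} (z : OrthonormalFrame h n) :
    (Nat.card (frameOrthogonal h z.1) : ℝ) = (q : ℝ) ^ (2 * (m : ℤ) - 2 * n) ∧
    (Nat.card {w : frameOrthogonal h z.1 // h w w = 1} : ℝ) =
      (q : ℝ) ^ (2 * (m : ℤ) - 2 * n - 1) * (1 - (-(q : ℝ)) ^ n * x) := by
  have hq := one_lt_of_natCard_eq_sq hK
  have hq0 : (q : ℝ) ≠ 0 := by positivity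
  induction n with
  | zero =>
    have ht : frameOrthogonal h z.1 = ⊤ := by
      ext v
      simp [mem_frameOrthogonal]
    constructor
    · rw [ht, Nat.card_congr Submodule.topEquiv.toEquiv, hV]
      push_cast
      rw [sub_zero, ← zpow_natCast]
      push_cast
      rfl
    · have e : {w : frameOrthogonal h z.1 // h w w = 1} ≃ {v : V // h v v = 1} :=
        (((LinearEquiv.ofEq _ _ ht).trans Submodule.topEquiv).toEquiv.subtypeEquiv
          fun w ↦ Iff.rfl)
      rw [Nat.card_congr e, hN]
      simp
  | succ n ih =>
    obtain ⟨z, hz⟩ := z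
    have hz' : ∀ i j, h (Fin.tail z i) (Fin.tail z j) = if i = j then 1 else 0 := fun i j ↦ by
      simpa [Fin.tail] using hz i.succ j.succ
    have hu : z 0 ∈ frameOrthogonal h (Fin.tail z) := by
      rw [mem_frameOrthogonal]
      intro i
      simpa [Fin.tail] using hz i.succ 0
    have hu1 : h (z 0) (z 0) = 1 := by simpa using hz 0 0
    obtain ⟨ih1, ih2⟩ := ih ⟨Fin.tail z, hz'⟩
    have h1 := congrArg (Nat.cast : ℕ → ℝ) (natCard_eq_of_unitVector h hK _ _ hu hu1)
    have h2 := congrArg (Nat.cast : ℕ → ℝ)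
      (natCard_norm_eq_one_of_unitVector h hK hτ hherm _ _ hu hu1)
    rw [← frameOrthogonal_succ] at h1 h2
    push_cast at h1 h2
    rw [ih1] at h1
    have h3 : (Nat.card (frameOrthogonal h z) : ℝ) =
        (q : ℝ) ^ (2 * (m : ℤ) - 2 * (n + 1 : ℕ)) := by
      rw [show 2 * (m : ℤ) - 2 * n = 2 * (m : ℤ) - 2 * (n + 1 : ℕ) + 2 by push_cast; ring,
        zpow_add₀ hq0, mul_comm] at h1
      exact (mul_left_cancel₀ (zpow_ne_zero 2 hq0) h1).symm
    refine ⟨h3, ?_⟩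
    rw [ih2, h3] at h2
    apply mul_left_cancel₀ hq0
    rw [eq_sub_of_add_eq' h2,
      show 2 * (m : ℤ) - 2 * n - 1 = 2 * (m : ℤ) - 2 * (n + 1 : ℕ) + 1 by push_cast; ring,
      zpow_add₀ hq0, zpow_sub₀ hq0 _ 1, zpow_one]
    field_simp
    ring

/-- An orthonormal family of `n + 1` vectors is an orthonormal family of `n` vectors
together with a vector of norm one orthogonal to it. -/
def orthonormalFrameSucc (hherm : ∀ v w, τ (h v w) = h w v) (n : ℕ) :
    OrthonormalFrame h (n + 1) ≃
      Σ z : OrthonormalFrame h n, {w : frameOrthogonal h z.1 // h w w = 1} where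
  toFun z := ⟨⟨Fin.tail z.1, fun i j ↦ by simpa [Fin.tail] using z.2 i.succ j.succ⟩,
    ⟨⟨z.1 0, by
      rw [mem_frameOrthogonal]
      intro i
      simpa [Fin.tail] using z.2 i.succ 0⟩, by simpa using z.2 0 0⟩⟩
  invFun x := ⟨Fin.cons x.2.1.1 x.1.1, by
    have hx := (mem_frameOrthogonal h).1 x.2.1.2
    have hx1 := x.2.2
    have hx' (i) : h x.2.1.1 (x.1.1 i) = 0 := by rw [← hherm, hx, map_zero]
    intro i j
    refine Fin.cases ?_ (fun i ↦ ?_) i <;> refine Fin.cases ?_ (fun j ↦ ?_) j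
    · simpa using hx1
    · simpa [eq_comm] using hx' j
    · simpa using hx i
    · simpa using x.1.2 i j⟩
  left_inv z := Subtype.ext (Fin.cons_self_tail z.1)
  right_inv x := rfl

theorem natCard_orthonormalFrame [Finite K] [Finite V] (hK : Nat.card K = q ^ 2)
    (hτ : ∀ x, τ x = x ^ q) (hherm : ∀ v w, τ (h v w) = h w v) {m : ℕ} {x : ℝ}
    (hV : Nat.card V = q ^ (2 * m))
    (hN : (Nat.card {v : V // h v v = 1} : ℝ) = (q : ℝ) ^ (2 * (m : ℤ) - 1) * (1 - x)) (n : ℕ) :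
    (Nat.card (OrthonormalFrame h n) : ℝ) =
      ∏ i ∈ Finset.range n, (q : ℝ) ^ (2 * (m : ℤ) - 2 * i - 1) * (1 - (-(q : ℝ)) ^ i * x) := by
  induction n with
  | zero =>
    have : Unique (OrthonormalFrame h 0) :=
      ⟨⟨⟨Fin.elim0, fun i ↦ i.elim0⟩⟩, fun _ ↦ Subtype.ext (Subsingleton.elim _ _)⟩
    rw [Nat.card_unique]
    simp
  | succ n ih =>
    have := Fintype.ofFinite (OrthonormalFrame h n)
    rw [Nat.card_congr (orthonormalFrameSucc h hherm n), Nat.card_sigma, Nat.cast_sum,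
      Finset.sum_congr rfl fun z _ ↦ (natCard_frameOrthogonal h hK hτ hherm hV hN z).2,
      Finset.sum_const, Finset.card_univ, nsmul_eq_mul, ← Nat.card_eq_fintype_card, ih,
      Finset.prod_range_succ]

end Frames

/-! ### Conjugate transposes, hermitian matrices and the polarization map. -/

section ConjTranspose

variable {R : Type*} [CommRing R] {ι κ μ : Type*}

/-- The conjugate transpose of a matrix with respect to a ring endomorphism. -/
def conjTrans (c : R →+* R) (X : Matrix ι κ R) : Matrix κ ι R := (X.map c).transpose

variable (c : R →+* R)

theorem conjTrans_mul [Fintype κ] (X : Matrix ι κ R) (Y : Matrix κ μ R) :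
    conjTrans c (X * Y) = conjTrans c Y * conjTrans c X := by
  rw [conjTrans, Matrix.map_mul, Matrix.transpose_mul, conjTrans, conjTrans]

theorem conjTrans_add (X Y : Matrix ι κ R) :
    conjTrans c (X + Y) = conjTrans c X + conjTrans c Y := by
  ext; simp [conjTrans]

theorem conjTrans_smul (r : R) (X : Matrix ι κ R) :
    conjTrans c (r • X) = c r • conjTrans c X := by
  ext; simp [conjTrans]

theorem conjTrans_one [DecidableEq ι] : conjTrans c (1 : Matrix ι ι R) = 1 := by
  rw [conjTrans, Matrix.map_one _ (map_zero c) (map_one c), Matrix.transpose_one]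

variable {c} in
theorem conjTrans_conjTrans (hc : ∀ x, c (c x) = x) (X : Matrix ι κ R) :
    conjTrans c (conjTrans c X) = X := by
  ext; simp [conjTrans, hc]

theorem conjTrans_map {S : Type*} [CommRing S] {d : S →+* S} {f : R →+* S}
    (hf : ∀ x, f (c x) = d (f x)) (X : Matrix ι κ R) :
    conjTrans d (X.map f) = (conjTrans c X).map f := by
  ext; simp [conjTrans, hf]

/-- The solutions of `ᵗx^* A x = 1`. -/
abbrev UnitSolutions (c : R →+* R) [Fintype ι] [DecidableEq κ] (A : Matrix ι ι R) : Type _ :=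
  {x : Matrix ι κ R // conjTrans c x * A * x = 1}

end ConjTranspose

section Hermitian

/-- The group of hermitian matrices. -/
def hermitianSubgroup {R : Type*} [CommRing R] (c : R →+* R) (n : ℕ) :
    AddSubgroup (Matrix (Fin n) (Fin n) R) where
  carrier := {X | conjTrans c X = X}
  add_mem' {X Y} hX hY := by
    change conjTrans c (X + Y) = X + Y
    rw [conjTrans_add, show conjTrans c X = X from hX, show conjTrans c Y = Y from hY]
  zero_mem' := by
    change conjTrans c 0 = 0
    ext; simp [conjTrans]
  neg_mem' {X} hX := by
    change conjTrans c (-X) = -X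
    rw [← neg_one_smul R X, conjTrans_smul, show conjTrans c X = X from hX, map_neg, map_one]

theorem mem_hermitianSubgroup {R : Type*} [CommRing R] {c : R →+* R} {n : ℕ}
    {X : Matrix (Fin n) (Fin n) R} : X ∈ hermitianSubgroup c n ↔ conjTrans c X = X := Iff.rfl

/-- The polarization `y ↦ ᵗy^* A x + ᵗx^* A y` of a hermitian form. -/
def polarization {R : Type*} [CommRing R] (c : R →+* R) {m n : ℕ} (A : Matrix (Fin m) (Fin m) R)
    (x : Matrix (Fin m) (Fin n) R) :
    Matrix (Fin m) (Fin n) R →+ Matrix (Fin n) (Fin n) R :=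
  AddMonoidHom.mk' (fun y ↦ conjTrans c y * A * x + conjTrans c x * A * y) fun y z ↦ by
    rw [conjTrans_add]
    simp only [Matrix.add_mul, Matrix.mul_add]
    abel

theorem polarization_apply {R : Type*} [CommRing R] (c : R →+* R) {m n : ℕ}
    (A : Matrix (Fin m) (Fin m) R) (x y : Matrix (Fin m) (Fin n) R) :
    polarization c A x y = conjTrans c y * A * x + conjTrans c x * A * y := rfl

variable {K : Type*} [Field K] {q : ℕ} {τ : K →+* K}

theorem range_polarization (hττ : ∀ x, τ (τ x) = x) (h2 : (2 : K) ≠ 0) {m n : ℕ}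
    {A : Matrix (Fin m) (Fin m) K} (hA : conjTrans τ A = A) {x : Matrix (Fin m) (Fin n) K}
    (hx : conjTrans τ x * A * x = 1) :
    (polarization τ A x).range = hermitianSubgroup τ n := by
  apply le_antisymm
  · rintro _ ⟨y, rfl⟩
    rw [mem_hermitianSubgroup, polarization_apply, conjTrans_add, conjTrans_mul, conjTrans_mul,
      conjTrans_mul, conjTrans_mul, hA, conjTrans_conjTrans hττ, conjTrans_conjTrans hττ, add_comm,
      Matrix.mul_assoc, Matrix.mul_assoc]
  · intro H hH
    rw [mem_hermitianSubgroup] at hH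
    -- Since `x` is a solution, each of the two terms of the polarization at `x(H/2)` equals `H/2`.
    refine ⟨x * ((2 : K)⁻¹ • H), ?_⟩
    have h1 : conjTrans τ ((2 : K)⁻¹ • H) = (2 : K)⁻¹ • H := by
      rw [conjTrans_smul, hH, map_inv₀, map_ofNat]
    rw [polarization_apply, conjTrans_mul, h1, Matrix.mul_assoc, Matrix.mul_assoc,
      ← Matrix.mul_assoc _ A x, hx, Matrix.mul_one, ← Matrix.mul_assoc, hx, Matrix.one_mul,
      ← add_smul, ← two_mul, mul_inv_cancel₀ h2, one_smul]

theorem natCard_matrix (ι κ R : Type*) [Finite ι] [Finite κ] :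
    Nat.card (Matrix ι κ R) = Nat.card R ^ (Nat.card ι * Nat.card κ) := by
  rw [mul_comm, pow_mul, ← Nat.card_fun, ← Nat.card_fun]
  rfl

theorem natCard_ker_mul_range {G H : Type*} [AddGroup G] [AddGroup H] (f : G →+ H) :
    Nat.card f.ker * Nat.card f.range = Nat.card G := by
  rw [← AddSubgroup.index_ker, AddSubgroup.card_mul_index]

theorem natCard_fiber_eq_ker {G H : Type*} [AddCommGroup G] [AddCommGroup H] (f : G →+ H) {b : H}
    (hb : b ∈ f.range) : Nat.card {a // f a = b} = Nat.card f.ker := by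
  obtain ⟨a₀, rfl⟩ := hb
  exact Nat.card_congr
    { toFun := fun a ↦ ⟨a.1 - a₀, by rw [AddMonoidHom.mem_ker, map_sub, a.2, sub_self]⟩
      invFun := fun a ↦ ⟨a.1 + a₀, by rw [map_add, AddMonoidHom.mem_ker.1 a.2, zero_add]⟩
      left_inv := fun a ↦ by simp
      right_inv := fun a ↦ by simp }

/-- The map `Y ↦ ᵗY^* + Y` has the hermitian matrices as image and the skew-hermitian ones as
kernel. Scaling by a skew scalar identifies the two, so the square of the count is `q^(2n²)`. -/
theorem natCard_hermitianSubgroup [Finite K] (hK : Nat.card K = q ^ 2) (hτ : ∀ x, τ x = x ^ q)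
    (h2 : (2 : K) ≠ 0) (n : ℕ) : Nat.card (hermitianSubgroup τ n) = q ^ (n * n) := by
  have hττ := map_map_self hK hτ
  obtain ⟨u, hu⟩ := exists_map_ne_self hK hτ
  have hε0 : u - τ u ≠ 0 := sub_ne_zero.2 (Ne.symm hu)
  have hε : τ (u - τ u) = -(u - τ u) := by rw [map_sub, hττ, neg_sub]
  set ε := u - τ u
  have hrange := range_polarization hττ h2 (conjTrans_one (ι := Fin n) τ)
    (x := (1 : Matrix (Fin n) (Fin n) K)) (by rw [conjTrans_one, Matrix.one_mul, Matrix.one_mul])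
  set L := polarization τ (1 : Matrix (Fin n) (Fin n) K) (1 : Matrix (Fin n) (Fin n) K) with hL
  have hker : Nat.card L.ker =
      Nat.card (hermitianSubgroup τ n) := by
    have hmem (X : Matrix (Fin n) (Fin n) K) :
        X ∈ L.ker ↔ conjTrans τ X = -X := by
      rw [AddMonoidHom.mem_ker, hL, polarization_apply, conjTrans_one]
      simp [add_eq_zero_iff_eq_neg]
    exact Nat.card_congr
      { toFun := fun X ↦ ⟨ε⁻¹ • X.1, by
          rw [mem_hermitianSubgroup, conjTrans_smul, (hmem _).1 X.2, map_inv₀, hε, inv_neg,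
            neg_smul_neg]⟩
        invFun := fun X ↦ ⟨ε • X.1, by
          rw [hmem, conjTrans_smul, mem_hermitianSubgroup.1 X.2, hε, neg_smul]⟩
        left_inv := fun X ↦ Subtype.ext (smul_inv_smul₀ hε0 X.1)
        right_inv := fun X ↦ Subtype.ext (inv_smul_smul₀ hε0 X.1) }
  have key := natCard_ker_mul_range L
  rw [hker, hrange, natCard_matrix, hK, Nat.card_fin, ← pow_mul, mul_comm 2, pow_mul, ← sq] at key
  exact Nat.pow_left_injective two_ne_zero key

theorem natCard_polarization_eq [Finite K] (hK : Nat.card K = q ^ 2) (hτ : ∀ x, τ x = x ^ q)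
    (h2 : (2 : K) ≠ 0) {m n : ℕ} {A : Matrix (Fin m) (Fin m) K} (hA : conjTrans τ A = A)
    {x : Matrix (Fin m) (Fin n) K} (hx : conjTrans τ x * A * x = 1)
    {H : Matrix (Fin n) (Fin n) K} (hH : conjTrans τ H = H) :
    q ^ (n * n) * Nat.card {y // polarization τ A x y = H} = q ^ (2 * (m * n)) := by
  have hrange := range_polarization (map_map_self hK hτ) h2 hA hx
  rw [natCard_fiber_eq_ker _ (hrange ▸ hH), ← natCard_hermitianSubgroup hK hτ h2, ← hrange,
    mul_comm, natCard_ker_mul_range, natCard_matrix, hK, Nat.card_fin, Nat.card_fin, ← pow_mul]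

end Hermitian

/-! ### Lifting solutions along a square-zero extension. -/

section Lifting

variable {Q' Q K : Type*} [CommRing Q'] [CommRing Q] [Field K] {c' : Q' →+* Q'} {c : Q →+* Q}
  {τ : K →+* K} {f : Q' →+* Q} {g : Q' →+* K} {t : Q'}

theorem conjTrans_lift_mul_lift (ht : c' t = t) (htt : t * t = 0) {m n : ℕ}
    (A : Matrix (Fin m) (Fin m) Q') (x y : Matrix (Fin m) (Fin n) Q') :
    conjTrans c' (x + t • y) * A * (x + t • y) =
      conjTrans c' x * A * x + t • polarization c' A x y := by
  rw [conjTrans_add, conjTrans_smul, ht, polarization_apply]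
  simp only [Matrix.add_mul, Matrix.mul_add, Matrix.smul_mul, Matrix.mul_smul, smul_add, smul_smul,
    htt, zero_smul, add_zero]
  abel

theorem polarization_map (hg' : ∀ x, g (c' x) = τ (g x)) {m n : ℕ}
    (A : Matrix (Fin m) (Fin m) Q') (x y : Matrix (Fin m) (Fin n) Q') :
    (polarization c' A x y).map g = polarization τ (A.map g) (x.map g) (y.map g) := by
  rw [polarization_apply, polarization_apply, Matrix.map_add _ (map_add g), Matrix.map_mul,
    Matrix.map_mul, Matrix.map_mul, Matrix.map_mul, conjTrans_map c' hg', conjTrans_map c' hg']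

theorem smul_matrix_eq_zero_iff (hgt : ∀ x, t * x = 0 ↔ g x = 0) {ι κ : Type*}
    (X : Matrix ι κ Q') : t • X = 0 ↔ X.map g = 0 := by
  simp [← Matrix.ext_iff, hgt]

theorem exists_smul_eq_of_map_eq_zero (hft : ∀ x, f x = 0 → ∃ y, x = t * y) {ι κ : Type*}
    {X : Matrix ι κ Q'} (hX : X.map f = 0) : ∃ Y : Matrix ι κ Q', X = t • Y := by
  choose Y hY using fun i j ↦ hft (X i j) (congrFun (congrFun hX i) j)
  exact ⟨Matrix.of Y, by ext i j; simp [← hY]⟩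

/-- Reduction of solutions along a ring homomorphism commuting with the conjugations. -/
def UnitSolutions.map {m n : ℕ} (f : Q' →+* Q) (hf : ∀ x, f (c' x) = c (f x))
    {A : Matrix (Fin m) (Fin m) Q'} (x : UnitSolutions (κ := Fin n) c' A) :
    UnitSolutions (κ := Fin n) c (A.map f) :=
  ⟨x.1.map f, by
    rw [conjTrans_map c' hf, ← Matrix.map_mul, ← Matrix.map_mul, x.2,
      Matrix.map_one _ (map_zero f) (map_one f)]⟩

/-- The model is `Q' = S/π^(d+1)`, `Q = S/π^d`, `K = S/π` and `t = π^d`: the kernel of `f` is `tQ'`,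
and multiplication by `t` sees only residues in `K`. The fibre is thus a fibre of the polarization
over `K`. -/
theorem natCard_fiber_unitSolutions_map [Finite K] {q : ℕ} (hK : Nat.card K = q ^ 2)
    (hτ : ∀ x, τ x = x ^ q) (h2 : (2 : K) ≠ 0)
    (hf : Function.Surjective f) (hg : Function.Surjective g)
    (hf' : ∀ x, f (c' x) = c (f x)) (hg' : ∀ x, g (c' x) = τ (g x)) (hcc : ∀ x, c' (c' x) = x)
    (ht : c' t = t) (htt : t * t = 0) (hft : ∀ x, f x = 0 ↔ ∃ y, x = t * y)
    (hgt : ∀ x, t * x = 0 ↔ g x = 0) {m n : ℕ} {A : Matrix (Fin m) (Fin m) Q'}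
    (hA : conjTrans c' A = A) (x₀ : UnitSolutions (κ := Fin n) c (A.map f)) :
    q ^ (n * n) * Nat.card {x : UnitSolutions (κ := Fin n) c' A // x.map f hf' = x₀} =
      q ^ (2 * (m * n)) := by
  obtain ⟨x, hx⟩ : ∃ x : Matrix (Fin m) (Fin n) Q', x.map f = x₀.1 :=
    ⟨x₀.1.map (Function.surjInv hf), by ext; simp [Function.surjInv_eq hf]⟩
  have hfx : (conjTrans c' x * A * x).map f = 1 := by
    rw [Matrix.map_mul, Matrix.map_mul, ← conjTrans_map c' hf', hx]
    exact x₀.2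
  obtain ⟨H, hH⟩ : ∃ H : Matrix (Fin n) (Fin n) Q', conjTrans c' x * A * x - 1 = t • H := by
    apply exists_smul_eq_of_map_eq_zero fun y ↦ (hft y).1
    rw [Matrix.map_sub _ (map_sub f), hfx, Matrix.map_one _ (map_zero f) (map_one f), sub_self]
  have hgt0 : g t = 0 := (hgt t).1 htt
  have hgx : conjTrans τ (x.map g) * A.map g * x.map g = 1 := by
    rw [conjTrans_map c' hg', ← Matrix.map_mul, ← Matrix.map_mul, sub_eq_iff_eq_add.1 hH,
      Matrix.map_add _ (map_add g), Matrix.map_one _ (map_zero g) (map_one g)]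
    ext; simp [hgt0]
  have hgA : conjTrans τ (A.map g) = A.map g := by rw [conjTrans_map c' hg', hA]
  -- `H` is determined only up to the annihilator of `t`, so its symmetry is available only after
  -- reduction to `K`.
  have hgH : conjTrans τ (-(H.map g)) = -(H.map g) := by
    have h1 : t • (conjTrans c' H - H) = 0 := by
      have h3 : conjTrans c' (1 + t • H) = 1 + t • H := by
        rw [← sub_eq_iff_eq_add'.1 hH, conjTrans_mul, conjTrans_mul, hA, conjTrans_conjTrans hcc,
          Matrix.mul_assoc]
      rw [conjTrans_add, conjTrans_one, conjTrans_smul, ht] at h3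
      rw [smul_sub, add_left_cancel h3, sub_self]
    rw [smul_matrix_eq_zero_iff hgt, Matrix.map_sub _ (map_sub g), ← conjTrans_map c' hg',
      sub_eq_zero] at h1
    rw [← neg_one_smul K, conjTrans_smul, h1, map_neg, map_one]
  rw [← natCard_polarization_eq hK hτ h2 hgA hgx hgH]
  congr 1
  have hlift (y : Matrix (Fin m) (Fin n) Q') :
      conjTrans c' (x + t • y) * A * (x + t • y) = 1 ↔
        polarization τ (A.map g) (x.map g) (y.map g) = -(H.map g) := by
    rw [conjTrans_lift_mul_lift ht htt, sub_eq_iff_eq_add'.1 hH, add_assoc, ← smul_add,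
      add_eq_left, smul_matrix_eq_zero_iff hgt, Matrix.map_add _ (map_add g),
      polarization_map hg', add_comm, add_eq_zero_iff_eq_neg]
  have hs (y : Matrix (Fin m) (Fin n) K) : (y.map (Function.surjInv hg)).map g = y := by
    ext; simp [Function.surjInv_eq hg]
  symm
  refine Nat.card_eq_of_bijective
    (fun y : {y // polarization τ (A.map g) (x.map g) y = -(H.map g)} ↦
      (⟨⟨x + t • y.1.map (Function.surjInv hg), (hlift _).2 (by rw [hs]; exact y.2)⟩, ?_⟩ :
        {x : UnitSolutions (κ := Fin n) c' A // x.map f hf' = x₀})) ⟨?_, ?_⟩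
  · apply Subtype.ext
    change (x + t • y.1.map (Function.surjInv hg)).map f = x₀.1
    have hft0 : f t = 0 := (hft t).2 ⟨1, (mul_one t).symm⟩
    rw [Matrix.map_add _ (map_add f), hx]
    ext; simp [hft0]
  · intro y z hyz
    have h1 : x + t • y.1.map (Function.surjInv hg) = x + t • z.1.map (Function.surjInv hg) :=
      congrArg (fun w ↦ w.1.1) hyz
    have h3 := add_left_cancel h1
    rw [← sub_eq_zero, ← smul_sub, smul_matrix_eq_zero_iff hgt, Matrix.map_sub _ (map_sub g), hs,
      hs, sub_eq_zero] at h3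
    exact Subtype.ext h3
  · rintro ⟨⟨w, hw⟩, hwx⟩
    have hwf : w.map f = x₀.1 := congrArg Subtype.val hwx
    obtain ⟨y, hy⟩ : ∃ y, w - x = t • y :=
      exists_smul_eq_of_map_eq_zero (fun y ↦ (hft y).1)
        (by rw [Matrix.map_sub _ (map_sub f), hwf, hx, sub_self])
    obtain rfl : w = x + t • y := sub_eq_iff_eq_add'.1 hy
    refine ⟨⟨y.map g, (hlift y).1 hw⟩, ?_⟩
    apply Subtype.ext
    apply Subtype.ext
    change x + t • (y.map g).map (Function.surjInv hg) = x + t • y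
    rw [add_right_inj, ← sub_eq_zero, ← smul_sub, smul_matrix_eq_zero_iff hgt,
      Matrix.map_sub _ (map_sub g), hs, sub_self]

theorem natCard_unitSolutions_lift [Finite K] {q : ℕ} (hK : Nat.card K = q ^ 2)
    (hτ : ∀ x, τ x = x ^ q) (h2 : (2 : K) ≠ 0)
    (hf : Function.Surjective f) (hg : Function.Surjective g)
    (hf' : ∀ x, f (c' x) = c (f x)) (hg' : ∀ x, g (c' x) = τ (g x)) (hcc : ∀ x, c' (c' x) = x)
    (ht : c' t = t) (htt : t * t = 0) (hft : ∀ x, f x = 0 ↔ ∃ y, x = t * y)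
    (hgt : ∀ x, t * x = 0 ↔ g x = 0) {m n : ℕ} {A : Matrix (Fin m) (Fin m) Q'}
    (hA : conjTrans c' A = A) :
    q ^ (n * n) * Nat.card (UnitSolutions (κ := Fin n) c' A) =
      q ^ (2 * (m * n)) * Nat.card (UnitSolutions (κ := Fin n) c (A.map f)) := by
  have hq := one_lt_of_natCard_eq_sq hK
  have hfib := natCard_fiber_unitSolutions_map (n := n) hK hτ h2 hf hg hf' hg' hcc ht htt hft hgt hA
  by_cases hne : IsEmpty (UnitSolutions (κ := Fin n) c (A.map f))
  · have : IsEmpty (UnitSolutions (κ := Fin n) c' A) := ⟨fun x ↦ hne.false (x.map f hf')⟩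
    simp
  obtain ⟨x₁⟩ := not_isEmpty_iff.1 hne
  set N := Nat.card {x : UnitSolutions (κ := Fin n) c' A // x.map f hf' = x₁} with hN
  have hN0 : N ≠ 0 := by
    intro h0
    have := hfib x₁
    rw [← hN, h0, mul_zero] at this
    exact (pow_pos (by lia) _).ne this
  have hfibN (x₀ : UnitSolutions (κ := Fin n) c (A.map f)) :
      Nat.card {x : UnitSolutions (κ := Fin n) c' A // x.map f hf' = x₀} = N :=
    Nat.eq_of_mul_eq_mul_left (pow_pos (by lia) (n * n)) ((hfib x₀).trans (hfib x₁).symm)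
  have e : UnitSolutions (κ := Fin n) c' A ≃ UnitSolutions (κ := Fin n) c (A.map f) × Fin N :=
    (Equiv.sigmaFiberEquiv fun x : UnitSolutions (κ := Fin n) c' A ↦ x.map f hf').symm.trans <|
      (Equiv.sigmaCongrRight fun x₀ ↦
        -- A nonzero `Nat.card` is what guarantees that the fibre is finite.
        have := Nat.finite_of_card_ne_zero ((hfibN x₀).trans_ne hN0)
        Finite.equivFinOfCardEq (hfibN x₀)).trans (Equiv.sigmaEquivProd _ _)
  rw [Nat.card_congr e, Nat.card_prod, Nat.card_fin, ← hfib x₁, ← hN]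
  ring

end Lifting

/-! ### The count modulo `π`: columns of a solution as a frame for a diagonal form. -/

section DiagonalForm

variable {K : Type*} [Field K] {q : ℕ} {τ : K →+* K}

/-- The sesquilinear form `∑ a i * (τ (v i) * w i)`. -/
def diagonalForm (τ : K →+* K) {m : ℕ} (a : Fin m → K) : (Fin m → K) →ₛₗ[τ] (Fin m → K) →ₗ[K] K :=
  LinearMap.mk₂'ₛₗ τ (RingHom.id K) (fun v w ↦ ∑ i, a i * (τ (v i) * w i))
    (fun v v' w ↦ by
      rw [← Finset.sum_add_distrib]
      exact Finset.sum_congr rfl fun i _ ↦ by rw [Pi.add_apply, map_add]; ring)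
    (fun r v w ↦ by
      rw [smul_eq_mul, Finset.mul_sum]
      exact Finset.sum_congr rfl fun i _ ↦ by rw [Pi.smul_apply, smul_eq_mul, map_mul]; ring)
    (fun v w w' ↦ by
      rw [← Finset.sum_add_distrib]
      exact Finset.sum_congr rfl fun i _ ↦ by rw [Pi.add_apply]; ring)
    (fun r v w ↦ by
      rw [RingHom.id_apply, smul_eq_mul, Finset.mul_sum]
      exact Finset.sum_congr rfl fun i _ ↦ by rw [Pi.smul_apply, smul_eq_mul]; ring)

theorem diagonalForm_apply {m : ℕ} (a v w : Fin m → K) :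
    diagonalForm τ a v w = ∑ i, a i * (τ (v i) * w i) := rfl

theorem diagonalForm_hermitian (hττ : ∀ x, τ (τ x) = x) {m : ℕ} {a : Fin m → K}
    (ha : ∀ i, τ (a i) = a i) (v w : Fin m → K) :
    τ (diagonalForm τ a v w) = diagonalForm τ a w v := by
  rw [diagonalForm_apply, diagonalForm_apply, map_sum]
  refine Finset.sum_congr rfl fun i _ ↦ ?_
  rw [map_mul, map_mul, hττ, ha, mul_comm (v i)]

theorem conjTrans_mul_diagonal_mul_apply {m n : ℕ} (a : Fin m → K) (x : Matrix (Fin m) (Fin n) K)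
    (i j : Fin n) :
    (conjTrans τ x * Matrix.diagonal a * x) i j = diagonalForm τ a (x.col i) (x.col j) := by
  rw [Matrix.mul_apply, diagonalForm_apply]
  refine Finset.sum_congr rfl fun l _ ↦ ?_
  rw [Matrix.mul_diagonal, conjTrans, Matrix.transpose_apply, Matrix.map_apply, Matrix.col_apply,
    Matrix.col_apply]
  ring

/-- The columns of a solution of `ᵗx^* A x = 1` with `A` diagonal are an orthonormal family. -/
def unitSolutionsEquivFrame {m : ℕ} (a : Fin m → K) (n : ℕ) :
    UnitSolutions (κ := Fin n) τ (Matrix.diagonal a) ≃ OrthonormalFrame (diagonalForm τ a) n where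
  toFun x := ⟨x.1.col, fun i j ↦ by
    rw [← conjTrans_mul_diagonal_mul_apply, x.2, Matrix.one_apply]⟩
  invFun z := ⟨Matrix.of fun i j ↦ z.1 j i, by
    ext i j
    rw [conjTrans_mul_diagonal_mul_apply, Matrix.one_apply]
    exact z.2 i j⟩
  left_inv _ := rfl
  right_inv _ := rfl

theorem sum_range_ite_lt {k m : ℕ} (hk : k ≤ m) :
    ∑ i ∈ Finset.range m, (if i < k then 0 else 1 : ℤ) = m - k := by
  induction m, hk using Nat.le_induction with
  | base =>
    rw [sub_self]
    exact Finset.sum_eq_zero fun i hi ↦ if_pos (Finset.mem_range.1 hi)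
  | succ m hkm ih =>
    rw [Finset.sum_range_succ, ih, if_neg (by lia)]
    push_cast
    ring

theorem natCard_unitSolutions_diagonal [Finite K] (hK : Nat.card K = q ^ 2)
    (hτ : ∀ x, τ x = x ^ q) {k m : ℕ} (hk : k ≤ m) (n : ℕ) :
    (Nat.card (UnitSolutions (κ := Fin n) τ
        (Matrix.diagonal fun i : Fin m ↦ if (i : ℕ) < k then 0 else 1)) : ℝ) =
      ∏ i ∈ Finset.range n, (q : ℝ) ^ (2 * (m : ℤ) - 2 * i - 1) *
        (1 - (-(q : ℝ)) ^ i * (-(q : ℝ)) ^ (-((m : ℤ) - k))) := by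
  rw [Nat.card_congr (unitSolutionsEquivFrame _ n)]
  refine natCard_orthonormalFrame _ hK hτ
    (diagonalForm_hermitian (map_map_self hK hτ) fun i ↦ by split_ifs <;> simp) ?_ ?_ n
  · rw [Nat.card_fun, hK, Nat.card_fin, ← pow_mul]
  · rw [← sum_range_ite_lt hk, ← Fin.sum_univ_eq_sum_range (fun i ↦ if i < k then (0 : ℤ) else 1) m]
    exact natCard_diagonal_norm_eq_one hK hτ fun i : Fin m ↦ (i : ℕ) < k

end DiagonalForm

/-! ### Rewriting the powers of `q` and the index of the product. -/

section Normalization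

theorem prod_zpow_eq {q : ℝ} (hq : q ≠ 0) (m : ℤ) (n : ℕ) :
    ∏ i ∈ Finset.range n, q ^ (2 * m - 2 * i - 1) = q ^ ((n : ℤ) * (2 * m - n)) := by
  induction n with
  | zero => simp
  | succ n ih =>
    rw [Finset.prod_range_succ, ih, ← zpow_add₀ hq]
    congr 1
    push_cast
    ring

/-- Substitute `l = N - i`. -/
theorem prod_range_eq_prod_Icc {q : ℝ} (hq : q ≠ 0) (k m n : ℤ) (N : ℕ) (hN : n = N) :
    ∏ i ∈ Finset.range N, (1 - q ^ i * q ^ (-(m - k))) =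
      ∏ l ∈ Finset.Icc 1 N, (1 - q ^ (-(l : ℤ) + k - (m - n))) := by
  refine Finset.prod_nbij' (fun i ↦ N - i) (fun l ↦ N - l) ?_ ?_ ?_ ?_ ?_
  · intro i hi
    rw [Finset.mem_range] at hi
    rw [Finset.mem_Icc]
    lia
  · intro i hi
    rw [Finset.mem_Icc] at hi
    rw [Finset.mem_range]
    lia
  · intro i hi
    rw [Finset.mem_range] at hi
    lia
  · intro i hi
    rw [Finset.mem_Icc] at hi
    lia
  · intro i hi
    rw [Finset.mem_range] at hi
    rw [← zpow_natCast, ← zpow_add₀ hq, Nat.cast_sub hi.le, hN]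
    congr 2
    ring

end Normalization

/-! ### Stability of the normalized count and the density. -/

section Density

variable {R S : Type*} [CommRing R] [CommRing S] [Algebra R S] {σ : S ≃ₐ[R] S} {π : R}

theorem mem_powIdeal {d : ℕ} {x : S} :
    x ∈ powIdeal S π d ↔ algebraMap R S π ^ d ∣ x := Ideal.mem_span_singleton

theorem powIdeal_anti {d e : ℕ} (h : d ≤ e) : powIdeal S π e ≤ powIdeal S π d := fun x hx ↦ by
  rw [mem_powIdeal] at *
  exact (pow_dvd_pow _ h).trans hx

theorem conjMod_involutive (hσ : ∀ x, σ (σ x) = x) (d : ℕ) (x : S ⧸ powIdeal S π d) :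
    conjMod σ π d (conjMod σ π d x) = x := by
  obtain ⟨x, rfl⟩ := Ideal.Quotient.mk_surjective x
  rw [conjMod_mk, conjMod_mk, hσ]

theorem factor_conjMod {d e : ℕ} (h : d ≤ e) (x : S ⧸ powIdeal S π e) :
    Ideal.Quotient.factor (powIdeal_anti h) (conjMod σ π e x) =
      conjMod σ π d (Ideal.Quotient.factor (powIdeal_anti h) x) := by
  obtain ⟨x, rfl⟩ := Ideal.Quotient.mk_surjective x
  rfl

theorem ncard_congruenceSolutions_one {m n : ℕ} (A : Matrix (Fin m) (Fin m) S) (d : ℕ) :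
    (congruenceSolutions σ π A (1 : Matrix (Fin n) (Fin n) S) d).ncard =
      Nat.card (UnitSolutions (κ := Fin n) (conjMod σ π d)
        (A.map (Ideal.Quotient.mk (powIdeal S π d)))) := by
  rw [← Nat.card_coe_set_eq]
  refine Nat.card_congr (Equiv.subtypeEquivRight fun x ↦ ?_)
  rw [congruenceSolutions, Set.mem_ofPred_eq, Matrix.map_one _ (map_zero _) (map_one _)]
  rfl

theorem ncard_congruenceSolutions_succ [IsDomain S] {q : ℕ} (hπ : algebraMap R S π ≠ 0)
    (hmax : (powIdeal S π 1).IsMaximal) (hq : q ≠ 0)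
    (hcard : Nat.card (S ⧸ powIdeal S π 1) = q ^ 2) (hτ : ∀ x, conjMod σ π 1 x = x ^ q)
    (hσ : ∀ x, σ (σ x) = x) (h2 : IsUnit (2 : S)) {m n : ℕ} {A : Matrix (Fin m) (Fin m) S}
    (hA : conjTrans (σ : S →+* S) A = A) {d : ℕ} (hd : 1 ≤ d) :
    q ^ (n * n) * (congruenceSolutions σ π A (1 : Matrix (Fin n) (Fin n) S) (d + 1)).ncard =
      q ^ (2 * (m * n)) *
        (congruenceSolutions σ π A (1 : Matrix (Fin n) (Fin n) S) d).ncard := by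
  let _ := Ideal.Quotient.field (powIdeal S π 1)
  have : Finite (S ⧸ powIdeal S π 1) :=
    Nat.finite_of_card_ne_zero (by rw [hcard]; positivity)
  rw [ncard_congruenceSolutions_one, ncard_congruenceSolutions_one]
  refine natCard_unitSolutions_lift (K := S ⧸ powIdeal S π 1) (τ := conjMod σ π 1)
    (f := Ideal.Quotient.factor (powIdeal_anti (Nat.le_succ d)))
    (g := Ideal.Quotient.factor (powIdeal_anti (Nat.le_add_left 1 d)))
    (t := Ideal.Quotient.mk _ (algebraMap R S π ^ d)) hcard hτ ?_
    (Ideal.Quotient.factor_surjective _) (Ideal.Quotient.factor_surjective _)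
    (factor_conjMod (Nat.le_succ d)) (factor_conjMod (Nat.le_add_left 1 d))
    (conjMod_involutive hσ _) ?_ ?_ ?_ ?_ ?_
  · have := h2.map (Ideal.Quotient.mk (powIdeal S π 1))
    rw [map_ofNat] at this
    exact this.ne_zero
  · rw [conjMod_mk, map_pow, σ.commutes]
  · rw [← map_mul, Ideal.Quotient.eq_zero_iff_mem, mem_powIdeal, ← pow_add]
    -- `2d ≥ d + 1` needs `d ≥ 1`, which is why stability starts at `d = 1`.
    exact pow_dvd_pow _ (by lia)
  · intro x
    obtain ⟨x, rfl⟩ := Ideal.Quotient.mk_surjective x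
    rw [Ideal.Quotient.factor_mk, Ideal.Quotient.eq_zero_iff_mem, mem_powIdeal]
    constructor
    · rintro ⟨y, rfl⟩
      exact ⟨Ideal.Quotient.mk _ y, map_mul _ _ _⟩
    · rintro ⟨y, hy⟩
      obtain ⟨y, rfl⟩ := Ideal.Quotient.mk_surjective y
      rw [← map_mul, Ideal.Quotient.eq, mem_powIdeal] at hy
      exact (dvd_sub_left (Dvd.intro _ rfl)).1 ((pow_dvd_pow _ (Nat.le_succ d)).trans hy)
  · intro x
    obtain ⟨x, rfl⟩ := Ideal.Quotient.mk_surjective x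
    rw [Ideal.Quotient.factor_mk, ← map_mul, Ideal.Quotient.eq_zero_iff_mem,
      Ideal.Quotient.eq_zero_iff_mem, mem_powIdeal, mem_powIdeal, pow_succ, pow_one,
      mul_dvd_mul_iff_left (pow_ne_zero d hπ)]
  · exact (conjTrans_map (σ : S →+* S) (f := Ideal.Quotient.mk (powIdeal S π (d + 1)))
      (fun _ ↦ rfl) A).trans (by rw [hA])

theorem diagPiOne_map_mk_one (k m : ℕ) :
    (diagPiOne S π k m).map (Ideal.Quotient.mk (powIdeal S π 1)) =
      Matrix.diagonal fun i : Fin m ↦ if (i : ℕ) < k then 0 else 1 := by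
  rw [diagPiOne, Matrix.diagonal_map (map_zero _)]
  congr 1
  ext i
  split_ifs
  · rw [Ideal.Quotient.eq_zero_iff_mem, mem_powIdeal, pow_one]
  · exact map_one _

theorem conjTrans_diagPiOne (k m : ℕ) :
    conjTrans (σ : S →+* S) (diagPiOne S π k m) = diagPiOne S π k m := by
  rw [conjTrans, diagPiOne, Matrix.diagonal_map (map_zero _), Matrix.diagonal_transpose]
  congr 1
  ext i
  split_ifs
  · exact σ.commutes π
  · exact map_one σ

theorem hasDensity_diagPiOne_one [IsDomain S] (hπ : algebraMap R S π ≠ 0)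
    (hmax : (powIdeal S π 1).IsMaximal) {q : ℕ} (hq : q = Nat.card (R ⧸ Ideal.span {π}))
    (hq0 : q ≠ 0)
    (hcard : Nat.card (S ⧸ powIdeal S π 1) = q ^ 2) (hτ : ∀ x, conjMod σ π 1 x = x ^ q)
    (hσ : ∀ x, σ (σ x) = x) (h2 : IsUnit (2 : S)) {k m : ℕ} (hk : k ≤ m) (n : ℕ) :
    HasDensity σ π (diagPiOne S π k m) (1 : Matrix (Fin n) (Fin n) S)
      (∏ l ∈ Finset.Icc 1 n, (1 - (-(q : ℝ)) ^ (-(l : ℤ) + (k : ℤ) - ((m : ℤ) - n)))) := by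
  have hq0' : (q : ℝ) ≠ 0 := Nat.cast_ne_zero.2 hq0
  rw [HasDensity, ← hq]
  refine tendsto_const_nhds.congr' ?_
  -- The sequence equals its limit for every `d ≥ 1`; the zero ring at `d = 0` is discarded.
  filter_upwards [eventually_ge_atTop 1] with d hd
  rw [← prod_range_eq_prod_Icc (neg_ne_zero.2 hq0') k m n n rfl, ← zpow_mul]
  induction d, hd using Nat.le_induction with
  | base =>
    let _ := Ideal.Quotient.field (powIdeal S π 1)
    have : Finite (S ⧸ powIdeal S π 1) :=
      Nat.finite_of_card_ne_zero (by rw [hcard]; positivity)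
    rw [ncard_congruenceSolutions_one, diagPiOne_map_mk_one]
    have h := natCard_unitSolutions_diagonal (τ := conjMod σ π 1) hcard hτ hk n
    rw [Finset.prod_mul_distrib, prod_zpow_eq hq0'] at h
    refine Eq.trans ?_ (congrArg _ h.symm)
    rw [← mul_assoc, ← zpow_add₀ hq0']
    simp
  | succ d hd ih =>
    have h := congrArg (Nat.cast : ℕ → ℝ) (ncard_congruenceSolutions_succ (n := n) hπ hmax hq0 hcard
      hτ hσ h2 (conjTrans_diagPiOne (σ := σ) (π := π) k m) hd)
    push_cast at h
    rw [ih]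
    have hs : (((congruenceSolutions σ π (diagPiOne S π k m)
        (1 : Matrix (Fin n) (Fin n) S) (d + 1)).ncard : ℕ) : ℝ) =
        (q : ℝ) ^ ((n : ℤ) * (2 * m - n)) * ((congruenceSolutions σ π (diagPiOne S π k m)
        (1 : Matrix (Fin n) (Fin n) S) d).ncard : ℕ) := by
      -- Cancelling `q^(n²)` against `q^(2mn)` leaves `n(2m - n)`, exactly the exponent in the
      -- normalization.
      apply mul_left_cancel₀ (pow_ne_zero (n * n) hq0')
      rw [h, ← mul_assoc ((q : ℝ) ^ (n * n)), ← zpow_natCast, ← zpow_natCast, ← zpow_add₀ hq0']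
      congr 2
      push_cast
      ring
    conv_rhs => rw [hs, ← mul_assoc, ← zpow_add₀ hq0']
    congr 2
    push_cast
    ring

end Density

end HermitianDensity

theorem propositionA5
    (p : ℕ) [Fact p.Prime] (hp : 2 < p)
    -- `F` is a finite unramified extension of `ℚ_p`
    (F : Type*) [Field F] [Algebra ℚ_[p] F] [FiniteDimensional ℚ_[p] F]
    [Algebra ℤ_[p] F] [IsScalarTower ℤ_[p] ℚ_[p] F]
    (hF : Algebra.FormallyUnramified ℤ_[p] (HermitianDensity.baseIntegers p F))
    -- `E` is an unramified quadratic extension of `F`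
    (E : Type*) [Field E] [Algebra F E] (hE2 : Module.finrank F E = 2)
    (hE : Algebra.FormallyUnramified (HermitianDensity.baseIntegers p F)
      (HermitianDensity.extIntegers p F E))
    -- `σ` is the nontrivial automorphism of `E` over `F`
    (σ : E ≃ₐ[F] E) (hσ : σ ≠ AlgEquiv.refl)
    -- `π` is a uniformizer of `O_F` and `q` is the cardinality of the residue field of `O_F`
    (π : HermitianDensity.baseIntegers p F) (hπ : Irreducible π)
    (q : ℕ) (hq : q = Nat.card (HermitianDensity.baseIntegers p F ⧸ Ideal.span {π}))
    (k m n : ℕ) (hk : k ≤ m) (hn : n ≤ m) (r : ℤ) (hr : r = (m : ℤ) - (n : ℤ)) :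
    HermitianDensity.HasDensity (HermitianDensity.conjIntegers p σ) π
      (HermitianDensity.diagPiOne (HermitianDensity.extIntegers p F E) π k m)
      (1 : Matrix (Fin n) (Fin n) (HermitianDensity.extIntegers p F E))
      (∏ l ∈ Finset.Icc 1 n, (1 - (-(q : ℝ)) ^ (-(l : ℤ) + (k : ℤ) - r))) := by
  open HermitianDensity in
  have : FiniteDimensional F E := Module.finite_of_finrank_pos (by lia)
  have := valuationRing_baseIntegers p F
  have := isPrincipalIdealRing_baseIntegers p F
  have := valuationRing_extIntegers p F E
  have := finite_extIntegers p F E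
  have := free_extIntegers p F E
  have := finite_quotient_span_irreducible p F hπ
  have hrank := (finrank_extIntegers p F E).trans hE2
  have hσ' := conjIntegers_ne_refl p hσ
  rw [hr]
  refine hasDensity_diagPiOne_one
    (algebraMap_ne_zero_of_finrank_eq_two hrank hπ.ne_zero)
    (isMaximal_powIdeal_one hπ) hq (hq ▸ Nat.card_pos.ne')
    (hq ▸ natCard_quotient_powIdeal_one hrank hπ)
    (hq ▸ conjMod_one_eq_pow hrank hπ _ hσ') (conjIntegers_involutive p hE2 σ)
    (isUnit_two_extIntegers p hp) hk n
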